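/- Let $A\in\mathbb R^{m\times n}$, $b\in\mathbb R^m$, $P\in\mathbb R^{q\times n}$ with $q\ge 1$, let $f:\mathbb R^q\to\mathbb R\cup\{\pm\infty\}$ be quasi-concave (all sets $\{y: f(y)\ge r\}$ are convex), and suppose that $S=\{x\in\mathbb R^n: Ax\ge b\}$ is nonempty. Consider the problem $$\text{(QCP)}\qquad \min f(Px)\quad\text{s.t.}\quad Ax\ge b .$$ Let $Y\in\mathbb R^{q\times o}$ and $Z\in\mathbb R^{q\times p}$ be such that $$C=\{Y\lambda:\lambda\in\mathbb R^o,\ \lambda\ge 0\}=\{y\in\mathbb R^q: Z^{\mathsf T}y\ge 0\}$$ is a polyhedral cone that is pointed ($C\cap(-C)=\{0\}$) and solid ($\operatorname{int}C\ne\emptyset$), and let $c\in\operatorname{int}C$. Assume (M) $f$ is $C$-monotone on $P[S]-C$: if $x,y\in P[S]-C$ and $y-x\in C$, then $f(x)\le f(y)$; (B) $P[S]=\{Px:x\in S\}$ is $C$-bounded: the recession cone of $P[S]$ is contained in $C$. Let an H-representation (a finite system of affine inequalities) of a polyhedron $\mathcal O_0\supseteq P[S]+C$ with recession cone $C$ be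 given. For $t\in\mathbb R^q$ consider the pair of dual linear programs $$(\mathrm P_2(t))\quad \min z\ \text{ s.t. } Ax\ge b,\ Z^{\mathsf T}Px\le Z^{\mathsf T}t+z\,Z^{\mathsf T}c,$$ $$(\mathrm D_2(t))\quad \max\, b^{\mathsf T}u-t^{\mathsf T}w\ \text{ s.t. } A^{\mathsf T}u=P^{\mathsf T}w,\ c^{\mathsf T}w=1,\ Y^{\mathsf T}w\ge 0,\ u\ge 0 .$$ The modified primal Benson algorithm starts with $\mathcal O=\mathcal O_0$ and repeats the following loop: choose a vertex $t$ of $\mathcal O$ at which $f$ is minimal among the vertices of $\mathcal O$; take optimal solutions $(x,z)$ of $(\mathrm P_2(t))$ and $(u,w)$ of $(\mathrm D_2(t))$; if $z>0$, replace $\mathcal O$ by $\mathcal O\cap\{y: w^{\mathsf T}y\ge b^{\mathsf T}u\}$ and continue; otherwise stop and return $x$. Then the algorithm is correct and finite, for every choice of the minimizing vertices and of the optimal solutions of the linear programs: (i) in every pass through the loop the operations can be carried out, i.e. the vertex set of $\mathcal O$ is finite, a minimizing vertex $t$ exists, and both $(\mathrm P_2(t))$ and $(\mathrm D_2(t))$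 have optimal solutions for each such $t$; (ii) there is no infinite run, i.e. every run stops after finitely many cuts; (iii) the vector $x$ returned is an optimal solution of (QCP), i.e. $x\in S$ and $f(Px)\le f(Px')$ for all $x'\in S$. -/

import Mathlib

open Matrix
open scoped Pointwise

/-- The data of the problem `min f (P x)` subject to `A x ≥ b`, together with the generator matrix
`Y` and the inequality matrix `Z` of the ordering cone and the direction `c`. -/
structure QCPData (m n q o p : ℕ) where
  A : Matrix (Fin m) (Fin n) ℝ
  b : Fin m → ℝ
  P : Matrix (Fin q) (Fin n) ℝ
  Y : Matrix (Fin q) (Fin o) ℝ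
  Z : Matrix (Fin q) (Fin p) ℝ
  c : Fin q → ℝ
  f : (Fin q → ℝ) → EReal

/-- The recession cone of a set `K`. -/
def recessionCone {q : ℕ} (K : Set (Fin q → ℝ)) : Set (Fin q → ℝ) :=
  {d | ∀ y ∈ K, ∀ s : ℝ, 0 ≤ s → y + s • d ∈ K}

/-- `g` is monotone on `D` for the ordering `x ≤ y ↔ y - x ∈ C`. -/
def ConeMonotoneOn {q : ℕ} (C D : Set (Fin q → ℝ)) (g : (Fin q → ℝ) → EReal) : Prop :=
  ∀ x ∈ D, ∀ y ∈ D, y - x ∈ C → g x ≤ g y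

/-- A system of finitely many affine inequalities; the pair `(w, β)` stands for `wᵀ y ≥ β`. -/
abbrev HRep (q : ℕ) := List ((Fin q → ℝ) × ℝ)

/-- The polyhedron described by an H-representation. -/
def HRep.polyhedron {q : ℕ} (L : HRep q) : Set (Fin q → ℝ) :=
  {y | ∀ h ∈ L, h.2 ≤ h.1 ⬝ᵥ y}

/-- The set of vertices of the polyhedron described by an H-representation. -/
def HRep.vertices {q : ℕ} (L : HRep q) : Set (Fin q → ℝ) :=
  Set.extremePoints ℝ L.polyhedron

namespace QCPData

variable {m n q o p : ℕ}

/-- The feasible set `S`. -/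
def feasible (D : QCPData m n q o p) : Set (Fin n → ℝ) :=
  {x | D.b ≤ D.A *ᵥ x}

/-- The image `P[S]` of the feasible set. -/
def image (D : QCPData m n q o p) : Set (Fin q → ℝ) :=
  (fun x => D.P *ᵥ x) '' D.feasible

/-- The cone given by the inequalities `Zᵀ y ≥ 0`. -/
def cone (D : QCPData m n q o p) : Set (Fin q → ℝ) :=
  {y | 0 ≤ D.Zᵀ *ᵥ y}

/-- The cone generated by the columns of `Y`. -/
def generatedCone (D : QCPData m n q o p) : Set (Fin q → ℝ) :=
  {y | ∃ l : Fin o → ℝ, 0 ≤ l ∧ y = D.Y *ᵥ l}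

/-- The upper image `P[S] + C`. -/
def upperImage (D : QCPData m n q o p) : Set (Fin q → ℝ) :=
  D.image + D.cone

/-- `x` is an optimal solution of `min f (P x)` subject to `A x ≥ b`. -/
def IsOptimal (D : QCPData m n q o p) (x : Fin n → ℝ) : Prop :=
  x ∈ D.feasible ∧ ∀ x' ∈ D.feasible, D.f (D.P *ᵥ x) ≤ D.f (D.P *ᵥ x')

/-- Feasibility for the translative scalarization
`min z` subject to `A x ≥ b`, `Zᵀ P x ≤ Zᵀ t + z • Zᵀ c`. -/
def PrimalFeasible (D : QCPData m n q o p) (t : Fin q → ℝ) (x : Fin n → ℝ) (z : ℝ) : Prop :=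
  D.b ≤ D.A *ᵥ x ∧ D.Zᵀ *ᵥ (D.P *ᵥ x) ≤ D.Zᵀ *ᵥ t + z • (D.Zᵀ *ᵥ D.c)

/-- Optimal solutions of the translative scalarization. -/
def PrimalOptimal (D : QCPData m n q o p) (t : Fin q → ℝ) (x : Fin n → ℝ) (z : ℝ) : Prop :=
  D.PrimalFeasible t x z ∧ ∀ x' z', D.PrimalFeasible t x' z' → z ≤ z'

/-- Feasibility for the dual program
`max bᵀ u - tᵀ w` subject to `Aᵀ u = Pᵀ w`, `cᵀ w = 1`, `Yᵀ w ≥ 0`, `u ≥ 0`. -/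
def DualFeasible (D : QCPData m n q o p) (u : Fin m → ℝ) (w : Fin q → ℝ) : Prop :=
  D.Aᵀ *ᵥ u = D.Pᵀ *ᵥ w ∧ D.c ⬝ᵥ w = 1 ∧ 0 ≤ D.Yᵀ *ᵥ w ∧ 0 ≤ u

/-- Optimal solutions of the dual program. -/
def DualOptimal (D : QCPData m n q o p) (t : Fin q → ℝ) (u : Fin m → ℝ) (w : Fin q → ℝ) : Prop :=
  D.DualFeasible u w ∧
    ∀ u' w', D.DualFeasible u' w' → D.b ⬝ᵥ u' - t ⬝ᵥ w' ≤ D.b ⬝ᵥ u - t ⬝ᵥ w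

/-- `t` minimizes `f` over the vertices of the current outer approximation. -/
def IsArgmin (D : QCPData m n q o p) (L : HRep q) (t : Fin q → ℝ) : Prop :=
  t ∈ L.vertices ∧ ∀ t' ∈ L.vertices, D.f t ≤ D.f t'

/-- A state of the algorithm: inside the loop with the current H-representation of the outer
approximation, or after the break, with the returned vector. -/
inductive State (n q : ℕ) where
  | running (L : HRep q) : State n q
  | done (x : Fin n → ℝ) : State n q

/-- One pass through the loop. The choice of the minimizing vertex `t` and of the optimal solutions
`(x, z)`, `(u, w)` of the pair of dual linear programs is arbitrary. -/
inductive Step (D : QCPData m n q o p) : State n q → State n q → Prop where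
  | cut (L : HRep q) (t : Fin q → ℝ) (x : Fin n → ℝ) (z : ℝ) (u : Fin m → ℝ) (w : Fin q → ℝ)
      (ht : D.IsArgmin L t) (hxz : D.PrimalOptimal t x z) (huw : D.DualOptimal t u w)
      (hz : 0 < z) : Step D (State.running L) (State.running ((w, D.b ⬝ᵥ u) :: L))
  | halt (L : HRep q) (t : Fin q → ℝ) (x : Fin n → ℝ) (z : ℝ) (u : Fin m → ℝ) (w : Fin q → ℝ)
      (ht : D.IsArgmin L t) (hxz : D.PrimalOptimal t x z) (huw : D.DualOptimal t u w)
      (hz : ¬ 0 < z) : Step D (State.running L) (State.done x)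

/-- The state `s` occurs in some run of the algorithm started with the H-representation `L₀`. -/
def Reaches (D : QCPData m n q o p) (L₀ : HRep q) (s : State n q) : Prop :=
  Relation.ReflTransGen D.Step (State.running L₀) s

end QCPData

/-! The invariant of a run is that `O` contains `P[S] + C` and has direction cone `C`. A dual
feasible `(u, w)` satisfies `w · y ≥ b · u` on `P[S] + C` and `w ≥ 0` on `C`, so every cut preserves
it.

Lower bound: `C` is pointed, so `O = conv(vert O) + C`. Each `y ∈ P[S]` thus lies above some `v ∈
conv(vert O)`. Monotonicity gives `f v ≤ f y`, and quasi-concavity gives `f t ≤ f v` for the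
minimizing vertex `t`. If `z ≤ 0`, then `t - P x ∈ C`. A vertex of `O` cannot lie strictly above a
point of `P[S]`, so `P x = t` and the bound is attained (`isArgmin_le`, `eq_of_mem_vertices`).

Finiteness: to each pass belong the set of rows of `A x ≥ b` active at `x` and the set of zero
coefficients in a representation of the slack `t + z c - P x` by the columns of `Y`. If a later pass
`(t', z')` shows the same pattern as an earlier one, complementary slackness puts `t' + z' c` on the
earlier cut's hyperplane, whence `w · t' = b · u - z' < b · u`. But `t'` satisfies that cut. So
patterns never repeat, and there are only finitely many (`dotProduct_eq_of_active_subset`,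
`not_exists_infinite_run`).

Solvability of the linear programs is strong duality, derived from Farkas' lemma. -/

/-! ### Farkas' lemma and linear programming duality -/

/-- **Farkas' lemma** for finitely many linear functionals on a real vector space. -/
theorem farkas_finset {V ι : Type*} [AddCommGroup V] [Module ℝ V] (s : Finset ι) :
    ∀ (a : ι → Module.Dual ℝ V) (b : Module.Dual ℝ V),
      (∀ x, (∀ i ∈ s, 0 ≤ a i x) → 0 ≤ b x) →
        ∃ u : ι → ℝ, (∀ i ∈ s, 0 ≤ u i) ∧ b = ∑ i ∈ s, u i • a i := by
  classical
  induction s using Finset.induction_on with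
  | empty =>
    intro a b h
    refine ⟨0, by simp, ?_⟩
    ext x
    have h1 := h x (by simp)
    have h2 := h (-x) (by simp)
    simp only [map_neg] at h2
    simp only [Finset.sum_empty, LinearMap.zero_apply]
    linarith
  | insert j s hj ih =>
    intro a b h
    by_cases hs : ∀ x, (∀ i ∈ s, 0 ≤ a i x) → 0 ≤ b x
    · obtain ⟨u, hu, hb⟩ := ih a b hs
      refine ⟨Function.update u j 0, ?_, ?_⟩
      · intro i hi
        rcases Finset.mem_insert.1 hi with rfl | hi
        · simp
        · rw [Function.update_of_ne (ne_of_mem_of_not_mem hi hj)]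
          exact hu i hi
      · rw [Finset.sum_insert hj, Function.update_self, zero_smul, zero_add, hb]
        refine Finset.sum_congr rfl fun i hi => ?_
        rw [Function.update_of_ne (ne_of_mem_of_not_mem hi hj)]
    · push Not at hs
      obtain ⟨x₀, hx₀, hbx₀⟩ := hs
      have hj₀ : a j x₀ < 0 := by
        by_contra hn
        refine absurd (h x₀ fun i hi => ?_) (not_le.2 hbx₀)
        rcases Finset.mem_insert.1 hi with rfl | hi
        · exact not_lt.1 hn
        · exact hx₀ i hi
      -- With `a j y = -1`, the map `x ↦ x + a j x • y` is a projection onto the kernel of `a j`.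
      obtain ⟨y, hy, hby, hjy⟩ : ∃ y, (∀ i ∈ s, 0 ≤ a i y) ∧ b y < 0 ∧ a j y = -1 := by
        have hpos : 0 < (-a j x₀)⁻¹ := inv_pos.2 (by linarith)
        refine ⟨(-a j x₀)⁻¹ • x₀, fun i hi => ?_, ?_, ?_⟩
        · rw [map_smul, smul_eq_mul]
          exact mul_nonneg hpos.le (hx₀ i hi)
        · rw [map_smul, smul_eq_mul]
          exact mul_neg_of_pos_of_neg hpos hbx₀
        · rw [map_smul, smul_eq_mul, inv_neg, neg_mul, inv_mul_cancel₀ hj₀.ne]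
      -- The functionals are composed with this projection; on its range the constraint `j` holds
      -- with equality, so induction applies.
      obtain ⟨u, hu, hb⟩ := ih (fun i => a i + a i y • a j) (b + b y • a j) (by
        intro x hx
        have hx' : 0 ≤ b (x + a j x • y) := by
          refine h _ fun i hi => ?_
          rcases Finset.mem_insert.1 hi with rfl | hi
          · simp [hjy]
          · have := hx i hi
            simp only [LinearMap.add_apply, LinearMap.smul_apply, smul_eq_mul] at this
            simp only [map_add, map_smul, smul_eq_mul]
            linarith
        simp only [map_add, map_smul, smul_eq_mul] at hx'
        simp only [LinearMap.add_apply, LinearMap.smul_apply, smul_eq_mul]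
        linarith)
      -- The coefficient of `a j` is read off from `hb`; it is nonnegative because `b y < 0`.
      refine ⟨Function.update u j (∑ i ∈ s, u i * a i y - b y), ?_, ?_⟩
      · intro i hi
        rcases Finset.mem_insert.1 hi with rfl | hi
        · rw [Function.update_self]
          have : 0 ≤ ∑ k ∈ s, u k * a k y :=
            Finset.sum_nonneg fun k hk => mul_nonneg (hu k hk) (hy k hk)
          linarith
        · rw [Function.update_of_ne (ne_of_mem_of_not_mem hi hj)]
          exact hu i hi
      · rw [Finset.sum_insert hj, Function.update_self]
        have hsum : ∑ i ∈ s, Function.update u j (∑ i ∈ s, u i * a i y - b y) i • a i =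
            ∑ i ∈ s, u i • a i :=
          Finset.sum_congr rfl fun i hi => by
            rw [Function.update_of_ne (ne_of_mem_of_not_mem hi hj)]
        simp only [smul_add, Finset.sum_add_distrib, smul_smul, ← Finset.sum_smul] at hb
        rw [hsum]
        ext v
        have := LinearMap.congr_fun hb v
        simp only [LinearMap.add_apply, LinearMap.smul_apply, smul_eq_mul] at this ⊢
        linarith
/-- An infeasible system of affine inequalities has a certificate of infeasibility. -/
theorem exists_infeasibility_certificate {V ι : Type*} [AddCommGroup V] [Module ℝ V] [Fintype ι]
    (φ : ι → Module.Dual ℝ V) (g : ι → ℝ) (h : ¬ ∃ x, ∀ i, g i ≤ φ i x) :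
    ∃ u : ι → ℝ, (∀ i, 0 ≤ u i) ∧ ∑ i, u i • φ i = 0 ∧ 0 < ∑ i, u i * g i := by
  -- Homogenization: `none` is the constraint `τ ≥ 0`, and `some i` is `φ i x ≥ g i τ`.
  -- Infeasibility of the original system means that these force `τ ≤ 0`.
  let a : Option ι → Module.Dual ℝ (V × ℝ) := fun i =>
    i.elim (LinearMap.snd ℝ V ℝ) fun i => φ i ∘ₗ LinearMap.fst ℝ V ℝ - g i • LinearMap.snd ℝ V ℝ
  obtain ⟨u, hu, hb⟩ := farkas_finset Finset.univ a (-LinearMap.snd ℝ V ℝ) (by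
    rintro ⟨x, τ⟩ hx
    by_contra hn
    have hτ : 0 < τ := by simpa using hn
    refine h ⟨τ⁻¹ • x, fun i => ?_⟩
    have hi := hx (some i) (Finset.mem_univ _)
    simp only [a, Option.elim, LinearMap.sub_apply, LinearMap.comp_apply, LinearMap.fst_apply,
      LinearMap.smul_apply, LinearMap.snd_apply, smul_eq_mul] at hi
    rw [map_smul, smul_eq_mul, ← div_eq_inv_mul, le_div_iff₀ hτ]
    linarith)
  rw [Fintype.sum_option] at hb
  refine ⟨fun i => u (some i), fun i => hu _ (Finset.mem_univ _), ?_, ?_⟩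
  · ext x
    have := LinearMap.congr_fun hb (x, 0)
    simpa [a, LinearMap.sum_apply] using this.symm
  · have := LinearMap.congr_fun hb (0, 1)
    simp [a, LinearMap.sum_apply] at this
    have := hu none (Finset.mem_univ _)
    linarith

/-- The affine form of Farkas' lemma: an affine inequality that follows from a feasible system of
affine inequalities is dominated by a nonnegative combination of the system. -/
theorem affine_farkas {V ι : Type*} [AddCommGroup V] [Module ℝ V] [Fintype ι]
    (φ : ι → Module.Dual ℝ V) (g : ι → ℝ) (c : Module.Dual ℝ V) (γ : ℝ)
    (hne : ∃ x, ∀ i, g i ≤ φ i x) (h : ∀ x, (∀ i, g i ≤ φ i x) → γ ≤ c x) :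
    ∃ u : ι → ℝ, (∀ i, 0 ≤ u i) ∧ c = ∑ i, u i • φ i ∧ γ ≤ ∑ i, u i * g i := by
  obtain ⟨x₀, hx₀⟩ := hne
  let a : Option ι → Module.Dual ℝ (V × ℝ) := fun i =>
    i.elim (LinearMap.snd ℝ V ℝ) fun i => φ i ∘ₗ LinearMap.fst ℝ V ℝ - g i • LinearMap.snd ℝ V ℝ
  obtain ⟨u, hu, hb⟩ := farkas_finset Finset.univ a
    (c ∘ₗ LinearMap.fst ℝ V ℝ - γ • LinearMap.snd ℝ V ℝ) (by
    rintro ⟨x, τ⟩ hx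
    have hτ : 0 ≤ τ := by simpa [a] using hx none (Finset.mem_univ _)
    have hi : ∀ i, g i * τ ≤ φ i x := fun i => by
      simpa [a] using hx (some i) (Finset.mem_univ _)
    simp only [LinearMap.sub_apply, LinearMap.comp_apply, LinearMap.fst_apply,
      LinearMap.smul_apply, LinearMap.snd_apply, smul_eq_mul, sub_nonneg]
    -- For `τ = 0` the vector `x` is a recession direction. If `c x < 0`, the multiple of `x` chosen
    -- below moves `x₀` to a feasible point where `c` equals `γ - 1`.
    rcases hτ.eq_or_lt with rfl | hτ
    · simp only [mul_zero] at hi ⊢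
      by_contra hn
      push Not at hn
      have h₀ := h x₀ hx₀
      have hs : 0 ≤ (c x₀ - γ + 1) / (-c x) := div_nonneg (by linarith) (by linarith)
      have := h (x₀ + ((c x₀ - γ + 1) / (-c x)) • x) fun i => by
        rw [map_add, map_smul, smul_eq_mul]
        linarith [hx₀ i, mul_nonneg hs (hi i)]
      rw [map_add, map_smul, smul_eq_mul, div_mul_eq_mul_div, div_neg, mul_div_cancel_right₀ _ hn.ne]
        at this
      linarith
    · have := h (τ⁻¹ • x) fun i => by
        rw [map_smul, smul_eq_mul, ← div_eq_inv_mul, le_div_iff₀ hτ]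
        exact hi i
      rwa [map_smul, smul_eq_mul, ← div_eq_inv_mul, le_div_iff₀ hτ] at this)
  rw [Fintype.sum_option] at hb
  refine ⟨fun i => u (some i), fun i => hu _ (Finset.mem_univ _), ?_, ?_⟩
  · ext x
    have := LinearMap.congr_fun hb (x, 0)
    simpa [a, LinearMap.sum_apply] using this
  · have := LinearMap.congr_fun hb (0, 1)
    simp [a, LinearMap.sum_apply] at this
    have := hu none (Finset.mem_univ _)
    linarith

/-- **Strong duality of linear programming**, with attainment of both optimal values. -/
theorem exists_primal_dual_optimal {V ι : Type*} [AddCommGroup V] [Module ℝ V] [Fintype ι]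
    (φ : ι → Module.Dual ℝ V) (g : ι → ℝ) (c : Module.Dual ℝ V) (B : ℝ)
    (hne : ∃ x, ∀ i, g i ≤ φ i x) (hB : ∀ x, (∀ i, g i ≤ φ i x) → B ≤ c x) :
    ∃ (x : V) (u : ι → ℝ), (∀ i, g i ≤ φ i x) ∧ (∀ i, 0 ≤ u i) ∧ c = ∑ i, u i • φ i ∧
      c x = ∑ i, u i * g i := by
  have weak : ∀ (u : ι → ℝ) (x : V), (∀ i, 0 ≤ u i) → (∀ i, g i ≤ φ i x) →
      ∑ i, u i * g i ≤ (∑ i, u i • φ i) x := fun u x hu hx => by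
    simp only [LinearMap.sum_apply, LinearMap.smul_apply, smul_eq_mul]
    exact Finset.sum_le_sum fun i _ => mul_le_mul_of_nonneg_left (hx i) (hu i)
  obtain ⟨x₀, hx₀⟩ := hne
  set vals : Set ℝ := c '' {x | ∀ i, g i ≤ φ i x}
  have hvals : vals.Nonempty := ⟨_, x₀, hx₀, rfl⟩
  have hbdd : BddBelow vals := ⟨B, by rintro _ ⟨x, hx, rfl⟩; exact hB x hx⟩
  have hinf : ∀ x, (∀ i, g i ≤ φ i x) → sInf vals ≤ c x := fun x hx =>
    csInf_le hbdd ⟨x, hx, rfl⟩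
  obtain ⟨u, hu, hcu, hgu⟩ := affine_farkas φ g c (sInf vals) ⟨x₀, hx₀⟩ hinf
  -- Attainment: the system stays feasible with the extra row `c x ≤ sInf vals`. In an infeasibility
  -- certificate, weight zero on that row contradicts the feasibility of `x₀`, and positive weight
  -- gives a lower bound above the infimum.
  obtain ⟨x, hx⟩ : ∃ x, ∀ i : Option ι,
      i.elim (-sInf vals) g ≤ (i.elim (-c) φ : Module.Dual ℝ V) x := by
    by_contra hn
    obtain ⟨v, hv, hv₀, hvg⟩ := exists_infeasibility_certificate
      (fun i : Option ι => (i.elim (-c) φ : Module.Dual ℝ V)) (fun i => i.elim (-sInf vals) g) hn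
    simp only [Fintype.sum_option, Option.elim] at hv₀ hvg
    have hv₁ : ∑ i, v (some i) • φ i = v none • c := by
      rw [smul_neg, neg_add_eq_zero] at hv₀
      exact hv₀.symm
    have hle : ∀ x, (∀ i, g i ≤ φ i x) → ∑ i, v (some i) * g i ≤ v none * c x := fun x hx => by
      have := weak (fun i => v (some i)) x (fun i => hv _) hx
      rwa [hv₁, LinearMap.smul_apply, smul_eq_mul] at this
    rcases (hv none).eq_or_lt with h0 | h0
    · have := hle x₀ hx₀
      rw [← h0] at this hvg
      linarith
    · have : (∑ i, v (some i) * g i) / v none ≤ sInf vals := le_csInf hvals (by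
        rintro _ ⟨x, hx, rfl⟩
        rw [div_le_iff₀ h0]
        linarith [hle x hx])
      rw [div_le_iff₀ h0] at this
      linarith
  have hxf : ∀ i, g i ≤ φ i x := fun i => hx (some i)
  have hxc : c x ≤ sInf vals := by simpa using hx none
  refine ⟨x, u, hxf, hu, hcu, le_antisymm (hxc.trans hgu) ?_⟩
  have := weak u x hu hxf
  rwa [← hcu] at this

/-! ### Polyhedra: recession cones, vertices and Minkowski decomposition -/

namespace HRep

variable {q : ℕ}

/-- The homogeneous system of an H-representation. -/
def homogeneousCone (L : HRep q) : Set (Fin q → ℝ) :=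
  {d | ∀ h ∈ L, 0 ≤ h.1 ⬝ᵥ d}

theorem recessionCone_polyhedron {L : HRep q} (hne : L.polyhedron.Nonempty) :
    recessionCone L.polyhedron = L.homogeneousCone := by
  obtain ⟨y, hy⟩ := hne
  ext d
  constructor
  · intro hd h hh
    by_contra hn
    push Not at hn
    have hyh := hy h hh
    have hs : 0 ≤ (h.1 ⬝ᵥ y - h.2 + 1) / (-(h.1 ⬝ᵥ d)) :=
      div_nonneg (by linarith) (by linarith)
    have := hd y hy _ hs h hh
    rw [dotProduct_add, dotProduct_smul, smul_eq_mul, div_mul_eq_mul_div, div_neg,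
      mul_div_cancel_right₀ _ hn.ne] at this
    linarith
  · intro hd y hy s hs h hh
    rw [dotProduct_add, dotProduct_smul, smul_eq_mul]
    linarith [hy h hh, mul_nonneg hs (hd h hh)]

theorem convex_homogeneousCone (L : HRep q) : Convex ℝ L.homogeneousCone := by
  intro x hx y hy a b ha hb _ h hh
  rw [dotProduct_add, dotProduct_smul, dotProduct_smul]
  exact add_nonneg (mul_nonneg ha (hx h hh)) (mul_nonneg hb (hy h hh))

open Classical in
/-- The inequalities of the H-representation that are strict at `y`. -/
noncomputable def inactive (L : HRep q) (y : Fin q → ℝ) : Finset ((Fin q → ℝ) × ℝ) :=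
  L.toFinset.filter fun h => h.1 ⬝ᵥ y ≠ h.2

theorem mem_inactive {L : HRep q} {y : Fin q → ℝ} {h : (Fin q → ℝ) × ℝ} :
    h ∈ L.inactive y ↔ h ∈ L ∧ h.1 ⬝ᵥ y ≠ h.2 := by
  simp [inactive]

/-- A ray leaves a polyhedron at a point where a further inequality becomes active. -/
theorem exists_exit_point {L : HRep q} {y d : Fin q → ℝ} (hy : y ∈ L.polyhedron)
    (hd : d ∉ L.homogeneousCone) :
    ∃ s : ℝ, 0 ≤ s ∧ y + s • d ∈ L.polyhedron ∧
      ∃ h ∈ L, h.1 ⬝ᵥ d < 0 ∧ h.1 ⬝ᵥ (y + s • d) = h.2 := by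
  classical
  have hne : (L.toFinset.filter fun h => h.1 ⬝ᵥ d < 0).Nonempty := by
    simp only [homogeneousCone, Set.mem_ofPred_eq, not_forall, not_le] at hd
    obtain ⟨h, hh, hlt⟩ := hd
    exact ⟨h, by simp [hh, hlt]⟩
  -- Ratio test: the inequality reached first along the ray.
  obtain ⟨h, hh, hmin⟩ := Finset.exists_min_image _
    (fun h : (Fin q → ℝ) × ℝ => (h.1 ⬝ᵥ y - h.2) / (-(h.1 ⬝ᵥ d))) hne
  simp only [Finset.mem_filter, List.mem_toFinset] at hh hmin
  have hs : 0 ≤ (h.1 ⬝ᵥ y - h.2) / (-(h.1 ⬝ᵥ d)) :=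
    div_nonneg (sub_nonneg.2 (hy h hh.1)) (by linarith [hh.2])
  refine ⟨_, hs, fun k hk => ?_, h, hh.1, hh.2, ?_⟩
  · rw [dotProduct_add, dotProduct_smul, smul_eq_mul]
    rcases lt_or_ge (k.1 ⬝ᵥ d) 0 with hkd | hkd
    · have := hmin k ⟨hk, hkd⟩
      rw [le_div_iff₀ (by linarith)] at this
      linarith
    · linarith [hy k hk, mul_nonneg hs hkd]
  · rw [dotProduct_add, dotProduct_smul, smul_eq_mul, div_mul_eq_mul_div, div_neg,
      mul_div_cancel_right₀ _ hh.2.ne]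
    ring

/-- A polyhedron without lines is the sum of the convex hull of its vertices and its cone of
directions. -/
theorem polyhedron_subset_convexHull_add {L : HRep q}
    (hpt : ∀ d, d ∈ L.homogeneousCone → -d ∈ L.homogeneousCone → d = 0) :
    L.polyhedron ⊆ convexHull ℝ L.vertices + L.homogeneousCone := by
  -- Induction on the number of inactive inequalities.
  suffices H : ∀ k, ∀ y ∈ L.polyhedron, (L.inactive y).card = k →
      y ∈ convexHull ℝ L.vertices + L.homogeneousCone from fun y hy => H _ y hy rfl
  intro k
  induction k using Nat.strong_induction_on with
  | _ k ih =>
  intro y hy hk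
  by_cases hv : y ∈ L.vertices
  · exact ⟨y, subset_convexHull ℝ _ hv, 0, fun h _ => by simp, by simp⟩
  -- A point that is not a vertex lies inside a segment of the polyhedron. Every inequality active
  -- at the point is active along the segment, so its direction `d` annihilates these rows.
  obtain ⟨d, hd0, hd⟩ : ∃ d : Fin q → ℝ, d ≠ 0 ∧ ∀ h ∈ L, h.1 ⬝ᵥ y = h.2 → h.1 ⬝ᵥ d = 0 := by
    simp only [vertices, mem_extremePoints, not_and, not_forall] at hv
    obtain ⟨y₁, hy₁, y₂, hy₂, ⟨a, b, ha, hb, hab, rfl⟩, hne⟩ := hv hy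
    refine ⟨y₂ - y₁, fun h0 => ?_, fun h hh he => ?_⟩
    · rw [sub_eq_zero] at h0
      subst h0
      have := (Convex.combo_self hab y₂).symm
      exact hne this this
    · have h₁ := hy₁ h hh
      have h₂ := hy₂ h hh
      simp only [dotProduct_add, dotProduct_smul, smul_eq_mul] at he
      rw [dotProduct_sub]
      have e₁ : h.1 ⬝ᵥ y₁ = h.2 := by
        refine le_antisymm ?_ h₁
        by_contra hn
        have := mul_lt_mul_of_pos_left (not_le.1 hn) ha
        have := mul_le_mul_of_nonneg_left h₂ hb.le
        have : a * h.2 + b * h.2 = h.2 := by rw [← add_mul, hab, one_mul]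
        linarith
      have e₂ : h.1 ⬝ᵥ y₂ = h.2 := by
        refine le_antisymm ?_ h₂
        by_contra hn
        have := mul_lt_mul_of_pos_left (not_le.1 hn) hb
        have := mul_le_mul_of_nonneg_left h₁ ha.le
        have : a * h.2 + b * h.2 = h.2 := by rw [← add_mul, hab, one_mul]
        linarith
      rw [e₁, e₂, sub_self]
  -- Moving along such a direction until the exit point keeps all active inequalities and activates
  -- another, so the induction hypothesis applies there.
  have key : ∀ e : Fin q → ℝ, (∀ h ∈ L, h.1 ⬝ᵥ y = h.2 → h.1 ⬝ᵥ e = 0) →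
      e ∉ L.homogeneousCone →
      ∃ s : ℝ, 0 < s ∧ y + s • e ∈ convexHull ℝ L.vertices + L.homogeneousCone := by
    intro e he hec
    obtain ⟨s, hs, hmem, h, hh, hlt, heq⟩ := exists_exit_point hy hec
    have hact : h.1 ⬝ᵥ y ≠ h.2 := fun h0 => hlt.ne (he h hh h0)
    refine ⟨s, hs.lt_of_ne' fun h0 => hact (by simpa [h0] using heq), ?_⟩
    refine ih _ ?_ _ hmem rfl
    rw [← hk]
    refine Finset.card_lt_card (Finset.ssubset_iff_subset_ne.2 ⟨fun k hk => ?_, fun h0 => ?_⟩)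
    · rw [mem_inactive] at hk ⊢
      refine ⟨hk.1, fun h0 => hk.2 ?_⟩
      rw [dotProduct_add, dotProduct_smul, he k hk.1 h0, smul_zero, add_zero, h0]
    · have : h ∈ L.inactive (y + s • e) := h0 ▸ mem_inactive.2 ⟨hh, hact⟩
      exact (mem_inactive.1 this).2 heq
  have hneg : ∀ h ∈ L, h.1 ⬝ᵥ y = h.2 → h.1 ⬝ᵥ (-d) = 0 := fun h hh h0 => by
    rw [dotProduct_neg, hd h hh h0, neg_zero]
  have hadd : ∀ e ∈ L.homogeneousCone, ∀ s : ℝ, 0 < s →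
      y + s • (-e) ∈ convexHull ℝ L.vertices + L.homogeneousCone →
      y ∈ convexHull ℝ L.vertices + L.homogeneousCone := by
    rintro e he s hs ⟨v, hv, r, hr, hvr⟩
    refine ⟨v, hv, r + s • e, fun h hh => ?_, ?_⟩
    · rw [dotProduct_add, dotProduct_smul]
      exact add_nonneg (hr h hh) (mul_nonneg hs.le (he h hh))
    · simp only at hvr ⊢
      rw [← add_assoc, hvr]
      simp
  by_cases h₁ : d ∈ L.homogeneousCone
  · obtain ⟨s, hs, hm⟩ := key (-d) hneg fun h₂ => hd0 (hpt d h₁ h₂)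
    exact hadd d h₁ s hs hm
  by_cases h₂ : -d ∈ L.homogeneousCone
  · obtain ⟨s, hs, hm⟩ := key d hd h₁
    exact hadd (-d) h₂ s hs (by rwa [neg_neg])
  -- Neither direction is a recession direction: `y` lies between the two exit points, with weights
  -- `r / (s + r)` and `s / (s + r)`.
  obtain ⟨s, hs, hm⟩ := key d hd h₁
  obtain ⟨r, hr, hm'⟩ := key (-d) hneg h₂
  have hconv := (convex_convexHull ℝ L.vertices).add L.convex_homogeneousCone
  have hsr : 0 < s + r := add_pos hs hr
  have := hconv hm hm' (div_nonneg hr.le hsr.le) (div_nonneg hs.le hsr.le)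
    (by field_simp; ring)
  convert this using 1
  ext i
  simp only [Pi.add_apply, Pi.smul_apply, Pi.neg_apply, smul_eq_mul]
  field_simp
  ring

/-- A vertex is determined by its set of inactive inequalities, a subset of a finite set. -/
theorem finite_vertices (L : HRep q) : L.vertices.Finite := by
  refine Set.Finite.of_finite_image (f := L.inactive)
    (((L.toFinset.powerset).finite_toSet).subset ?_) ?_
  · rintro _ ⟨y, _, rfl⟩
    exact Finset.mem_powerset.2 fun h hh => List.mem_toFinset.2 (mem_inactive.1 hh).1
  · intro y hy y' hy' he
    by_contra hne
    have hd : ∀ h ∈ L, h.1 ⬝ᵥ y = h.2 → h.1 ⬝ᵥ y' = h.2 := fun h hh h0 => by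
      by_contra hn
      have : h ∈ L.inactive y := he ▸ mem_inactive.2 ⟨hh, hn⟩
      exact (mem_inactive.1 this).2 h0
    have hyp := extremePoints_subset hy
    -- Since `y - y'` annihilates every row active at `y`, the segment from `y'` to `y` can be
    -- prolonged beyond `y`, which contradicts extremality.
    obtain ⟨s, hs, hm⟩ : ∃ s : ℝ, 0 < s ∧ y + s • (y - y') ∈ L.polyhedron := by
      by_cases hc : y - y' ∈ L.homogeneousCone
      · refine ⟨1, one_pos, fun h hh => ?_⟩
        rw [one_smul, dotProduct_add]
        linarith [hyp h hh, hc h hh]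
      · obtain ⟨s, hs, hm, h, hh, hlt, heq⟩ := exists_exit_point hyp hc
        refine ⟨s, hs.lt_of_ne' fun h0 => hlt.ne ?_, hm⟩
        have h1 : h.1 ⬝ᵥ y = h.2 := by simpa [h0] using heq
        rw [dotProduct_sub, h1, hd h hh h1, sub_self]
    have hs1 : 0 < 1 + s := by linarith
    have := (mem_extremePoints.1 hy).2 y' (extremePoints_subset hy') _ hm
      ⟨s / (1 + s), 1 / (1 + s), div_pos hs hs1, div_pos one_pos hs1, by field_simp; ring, by
        ext i
        simp only [Pi.add_apply, Pi.smul_apply, Pi.sub_apply, smul_eq_mul]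
        field_simp
        ring⟩
    exact hne this.1.symm

end HRep

/-! ### The ordering cone and the scalarized pair of linear programs -/

namespace QCPData

variable {m n q o p : ℕ} {D : QCPData m n q o p}

theorem add_mem_cone {x y : Fin q → ℝ} (hx : x ∈ D.cone) (hy : y ∈ D.cone) :
    x + y ∈ D.cone := by
  simp only [cone, Set.mem_ofPred_eq, mulVec_add] at *
  exact add_nonneg hx hy

theorem smul_mem_cone {x : Fin q → ℝ} {s : ℝ} (hs : 0 ≤ s) (hx : x ∈ D.cone) :
    s • x ∈ D.cone := by
  simp only [cone, Set.mem_ofPred_eq, mulVec_smul] at *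
  exact smul_nonneg hs hx

theorem zero_mem_cone : (0 : Fin q → ℝ) ∈ D.cone := by
  simp [cone]

theorem eq_zero_of_mem_cone_of_neg_mem_cone (hpointed : D.cone ∩ -D.cone = {0})
    {d : Fin q → ℝ} (h₁ : d ∈ D.cone) (h₂ : -d ∈ D.cone) : d = 0 := by
  have : d ∈ D.cone ∩ -D.cone := ⟨h₁, h₂⟩
  rwa [hpointed] at this

/-- `c + ε y` stays in the cone for small `ε > 0`; rescale by `ε⁻¹`. This makes every scalarization
feasible. -/
theorem exists_pos_add_smul_mem_cone (hc : D.c ∈ interior D.cone) (y : Fin q → ℝ) :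
    ∃ z : ℝ, 0 < z ∧ y + z • D.c ∈ D.cone := by
  have hcont : Continuous fun ε : ℝ => D.c + ε • y := by fun_prop
  have hev : ∀ᶠ ε : ℝ in nhds 0, D.c + ε • y ∈ interior D.cone :=
    hcont.continuousAt.eventually_mem (isOpen_interior.mem_nhds (by simpa using hc))
  have hev' : ∀ᶠ ε : ℝ in nhdsWithin 0 (Set.Ioi 0), D.c + ε • y ∈ interior D.cone :=
    nhdsWithin_le_nhds hev
  obtain ⟨ε, hε, hpos⟩ := (hev'.and self_mem_nhdsWithin).exists
  have hpos : 0 < ε := hpos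
  refine ⟨ε⁻¹, inv_pos.2 hpos, ?_⟩
  have := smul_mem_cone (inv_pos.2 hpos).le (interior_subset hε)
  rwa [smul_add, smul_smul, inv_mul_cancel₀ hpos.ne', one_smul, add_comm] at this

/-- Otherwise pointedness gives `c = 0`, so `0` is interior and the cone is the whole space, which
is not pointed for `q > 0`. -/
theorem neg_c_notMem_cone (hq : 0 < q) (hpointed : D.cone ∩ -D.cone = {0})
    (hc : D.c ∈ interior D.cone) : -D.c ∉ D.cone := by
  intro hn
  have hc0 : D.c = 0 :=
    eq_zero_of_mem_cone_of_neg_mem_cone hpointed (interior_subset hc) hn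
  have hall : ∀ y, y ∈ D.cone := fun y => by
    obtain ⟨z, _, hz⟩ := exists_pos_add_smul_mem_cone hc y
    simpa [hc0] using hz
  have := congr_fun (eq_zero_of_mem_cone_of_neg_mem_cone hpointed (hall 1) (hall (-1))) ⟨0, hq⟩
  simp at this

theorem primalFeasible_iff {t : Fin q → ℝ} {x : Fin n → ℝ} {z : ℝ} :
    D.PrimalFeasible t x z ↔ x ∈ D.feasible ∧ t + z • D.c - D.P *ᵥ x ∈ D.cone := by
  simp only [PrimalFeasible, feasible, cone, Set.mem_ofPred_eq, mulVec_sub, mulVec_add, mulVec_smul,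
    sub_nonneg]

theorem PrimalFeasible.mem_upperImage {t : Fin q → ℝ} {x : Fin n → ℝ} {z : ℝ}
    (h : D.PrimalFeasible t x z) : t + z • D.c ∈ D.upperImage := by
  rw [primalFeasible_iff] at h
  exact ⟨_, ⟨x, h.1, rfl⟩, _, h.2, by simp⟩

theorem DualFeasible.dotProduct_image {u : Fin m → ℝ} {w : Fin q → ℝ} (h : D.DualFeasible u w)
    (x : Fin n → ℝ) : w ⬝ᵥ (D.P *ᵥ x) = u ⬝ᵥ (D.A *ᵥ x) := by
  rw [dotProduct_mulVec, dotProduct_mulVec, ← mulVec_transpose, ← mulVec_transpose, h.1]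

theorem dotProduct_generator (w : Fin q → ℝ) (l : Fin o → ℝ) : w ⬝ᵥ (D.Y *ᵥ l) = (D.Yᵀ *ᵥ w) ⬝ᵥ l := by
  rw [dotProduct_mulVec, mulVec_transpose]

theorem DualFeasible.nonneg_of_mem_cone (hC : D.cone = D.generatedCone) {u : Fin m → ℝ}
    {w : Fin q → ℝ} (h : D.DualFeasible u w) {d : Fin q → ℝ} (hd : d ∈ D.cone) : 0 ≤ w ⬝ᵥ d := by
  rw [hC] at hd
  obtain ⟨l, hl, rfl⟩ := hd
  rw [dotProduct_generator]
  exact dotProduct_nonneg_of_nonneg h.2.2.1 hl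

theorem DualFeasible.le_dotProduct_image {u : Fin m → ℝ} {w : Fin q → ℝ} (h : D.DualFeasible u w)
    {x : Fin n → ℝ} (hx : x ∈ D.feasible) : D.b ⬝ᵥ u ≤ w ⬝ᵥ (D.P *ᵥ x) := by
  rw [h.dotProduct_image, dotProduct_comm]
  exact dotProduct_le_dotProduct_of_nonneg_left hx h.2.2.2

theorem DualFeasible.le_dotProduct (hC : D.cone = D.generatedCone) {u : Fin m → ℝ} {w : Fin q → ℝ}
    (h : D.DualFeasible u w) {y : Fin q → ℝ} (hy : y ∈ D.upperImage) : D.b ⬝ᵥ u ≤ w ⬝ᵥ y := by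
  obtain ⟨_, ⟨x, hx, rfl⟩, d, hd, rfl⟩ := hy
  rw [dotProduct_add]
  linarith [h.le_dotProduct_image hx, h.nonneg_of_mem_cone hC hd]

theorem DualFeasible.dotProduct_translate {u : Fin m → ℝ} {w : Fin q → ℝ} (h : D.DualFeasible u w)
    (t : Fin q → ℝ) (z : ℝ) : w ⬝ᵥ (t + z • D.c) = t ⬝ᵥ w + z := by
  rw [dotProduct_add, dotProduct_smul, dotProduct_comm w D.c, h.2.1, smul_eq_mul, mul_one,
    dotProduct_comm]

/-- Weak duality for the translative scalarization. -/
theorem PrimalFeasible.dual_le (hC : D.cone = D.generatedCone) {t : Fin q → ℝ} {x : Fin n → ℝ}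
    {z : ℝ} (hxz : D.PrimalFeasible t x z) {u : Fin m → ℝ} {w : Fin q → ℝ}
    (huw : D.DualFeasible u w) : D.b ⬝ᵥ u - t ⬝ᵥ w ≤ z := by
  have := huw.le_dotProduct hC hxz.mem_upperImage
  rw [huw.dotProduct_translate] at this
  linarith

/-- Strong duality for the translative scalarization. -/
theorem exists_primalFeasible_dualFeasible (hC : D.cone = D.generatedCone) (t : Fin q → ℝ) (B : ℝ)
    (hne : ∃ x z, D.PrimalFeasible t x z) (hB : ∀ x z, D.PrimalFeasible t x z → B ≤ z) :
    ∃ x z u w, D.PrimalFeasible t x z ∧ D.DualFeasible u w ∧ D.b ⬝ᵥ u - t ⬝ᵥ w = z := by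
  let Q : Matrix (Fin p) (Fin n) ℝ := D.Zᵀ * D.P
  let k : Fin p → ℝ := D.Zᵀ *ᵥ D.c
  let φ : Fin m ⊕ Fin p → Module.Dual ℝ ((Fin n → ℝ) × ℝ) := Sum.elim
    (fun i => LinearMap.proj i ∘ₗ D.A.mulVecLin ∘ₗ LinearMap.fst ℝ _ _)
    (fun j => k j • LinearMap.snd ℝ _ _ - LinearMap.proj j ∘ₗ Q.mulVecLin ∘ₗ LinearMap.fst ℝ _ _)
  let g : Fin m ⊕ Fin p → ℝ := Sum.elim D.b (fun j => -(D.Zᵀ *ᵥ t) j)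
  have hφ : ∀ v : (Fin n → ℝ) × ℝ, (∀ i, g i ≤ φ i v) ↔ D.PrimalFeasible t v.1 v.2 := by
    rintro ⟨x, z⟩
    simp only [Sum.forall, PrimalFeasible, Pi.le_def, φ, g, Q, k, Sum.elim_inl, Sum.elim_inr,
      LinearMap.comp_apply, LinearMap.fst_apply, mulVecLin_apply, LinearMap.proj_apply,
      LinearMap.sub_apply, LinearMap.smul_apply, LinearMap.snd_apply, smul_eq_mul, mulVec_mulVec,
      Pi.add_apply, Pi.smul_apply]
    refine and_congr Iff.rfl (forall_congr' fun j => ?_)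
    constructor <;> intro h <;> linarith
  obtain ⟨⟨x, z⟩, v, hfeas, hv, heq, hval⟩ := exists_primal_dual_optimal φ g
    (LinearMap.snd ℝ _ _) B (by obtain ⟨x, z, h⟩ := hne; exact ⟨(x, z), (hφ _).2 h⟩)
    (fun v h => hB _ _ ((hφ v).1 h))
  -- The multiplier identity as an equation in `(y, s)`: at `(y, 0)` it yields `Aᵀ u = Pᵀ w`, at
  -- `(0, 1)` it yields `cᵀ w = 1`.
  have hfun : ∀ y s, s = (fun i => v (Sum.inl i)) ⬝ᵥ (D.A *ᵥ y) +
      (s * ((fun j => v (Sum.inr j)) ⬝ᵥ k) - (fun j => v (Sum.inr j)) ⬝ᵥ (Q *ᵥ y)) := by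
    intro y s
    have := LinearMap.congr_fun heq (y, s)
    simp only [LinearMap.add_apply, LinearMap.sum_apply, Fintype.sum_sum_type, φ, Sum.elim_inl, Sum.elim_inr,
      LinearMap.comp_apply, LinearMap.fst_apply, mulVecLin_apply, LinearMap.proj_apply,
      LinearMap.sub_apply, LinearMap.smul_apply, LinearMap.snd_apply, smul_eq_mul] at this
    refine this.trans ?_
    simp only [dotProduct, Finset.mul_sum, mul_sub, Finset.sum_sub_distrib]
    congr 2
    exact Finset.sum_congr rfl fun j _ => by ring
  set u : Fin m → ℝ := fun i => v (Sum.inl i)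
  set r : Fin p → ℝ := fun j => v (Sum.inr j)
  have hr : 0 ≤ r := fun j => hv _
  -- The multipliers `r` of the cone constraints enter through `w = Z r`. Then `Yᵀ w ≥ 0` because
  -- the columns of `Y` satisfy the inequalities given by `Z`.
  refine ⟨x, z, u, D.Z *ᵥ r, (hφ _).1 hfeas, ⟨?_, ?_, ?_, fun i => hv _⟩, ?_⟩
  · refine dotProduct_eq _ _ fun y => ?_
    have := hfun y 0
    rw [mulVec_transpose, mulVec_transpose, ← dotProduct_mulVec, ← dotProduct_mulVec]
    have h2 : (D.Z *ᵥ r) ⬝ᵥ (D.P *ᵥ y) = r ⬝ᵥ (Q *ᵥ y) := by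
      rw [← mulVec_mulVec, dotProduct_mulVec r, vecMul_transpose]
    rw [h2]
    linarith
  · have := hfun 0 1
    simp only [mulVec_zero, dotProduct_zero] at this
    rw [dotProduct_comm, ← vecMul_transpose, ← dotProduct_mulVec]
    linarith
  · intro j
    have hcol : D.Y *ᵥ Pi.single j 1 ∈ D.cone := by
      rw [hC]
      exact ⟨_, by simp [Pi.single_nonneg], rfl⟩
    have : 0 ≤ (D.Z *ᵥ r) ⬝ᵥ (D.Y *ᵥ Pi.single j 1) := by
      rw [← vecMul_transpose, ← dotProduct_mulVec]
      exact dotProduct_nonneg_of_nonneg hr hcol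
    rw [dotProduct_mulVec, ← mulVec_transpose] at this
    simpa using this
  · simp only [LinearMap.snd_apply, Fintype.sum_sum_type, g, Sum.elim_inl, Sum.elim_inr] at hval
    rw [hval, dotProduct_comm t, ← vecMul_transpose, ← dotProduct_mulVec, dotProduct_comm D.b,
      sub_eq_add_neg, ← dotProduct_neg]
    rfl

/-! ### Outer approximations: invariance under cuts, solvability, lower bounds -/

/-- The properties of the outer approximation that the cuts preserve. -/
structure IsOuterApproximation (D : QCPData m n q o p) (L : HRep q) : Prop where
  upperImage_subset : D.upperImage ⊆ L.polyhedron
  homogeneousCone_eq : L.homogeneousCone = D.cone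

theorem upperImage_nonempty (hS : D.feasible.Nonempty) : D.upperImage.Nonempty := by
  obtain ⟨x, hx⟩ := hS
  exact ⟨_, _, ⟨x, hx, rfl⟩, 0, zero_mem_cone, rfl⟩

theorem IsOuterApproximation.cut (hC : D.cone = D.generatedCone) {L : HRep q}
    (hL : D.IsOuterApproximation L) {u : Fin m → ℝ} {w : Fin q → ℝ} (huw : D.DualFeasible u w) :
    D.IsOuterApproximation ((w, D.b ⬝ᵥ u) :: L) := by
  constructor
  · intro y hy h hh
    rcases List.mem_cons.1 hh with rfl | hh
    · exact huw.le_dotProduct hC hy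
    · exact hL.upperImage_subset hy h hh
  · rw [← hL.homogeneousCone_eq]
    ext d
    refine ⟨fun hd h hh => hd h (List.mem_cons_of_mem _ hh), fun hd h hh => ?_⟩
    rcases List.mem_cons.1 hh with rfl | hh
    · rw [hL.homogeneousCone_eq] at hd
      exact huw.nonneg_of_mem_cone hC hd
    · exact hd h hh

/-- Since `-c` is not in the cone, some row `h` of `L` has `h.1 · c > 0`. As `t + z c` lies in the
polyhedron for feasible `z`, this row bounds `z` from below, and strong duality applies. -/
theorem IsOuterApproximation.exists_optimal (hq : 0 < q) (hS : D.feasible.Nonempty)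
    (hC : D.cone = D.generatedCone) (hpointed : D.cone ∩ -D.cone = {0})
    (hc : D.c ∈ interior D.cone) {L : HRep q} (hL : D.IsOuterApproximation L) (t : Fin q → ℝ) :
    ∃ x z u w, D.PrimalOptimal t x z ∧ D.DualOptimal t u w ∧ D.b ⬝ᵥ u - t ⬝ᵥ w = z := by
  have hn := neg_c_notMem_cone hq hpointed hc
  rw [← hL.homogeneousCone_eq] at hn
  simp only [HRep.homogeneousCone, Set.mem_ofPred_eq, not_forall, not_le, dotProduct_neg,
    neg_neg_iff_pos] at hn
  obtain ⟨h, hh, hpos⟩ := hn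
  obtain ⟨x₀, hx₀⟩ := hS
  obtain ⟨z₀, _, hz₀⟩ := exists_pos_add_smul_mem_cone hc (t - D.P *ᵥ x₀)
  obtain ⟨x, z, u, w, hxz, huw, hval⟩ := exists_primalFeasible_dualFeasible hC t
    ((h.2 - h.1 ⬝ᵥ t) / (h.1 ⬝ᵥ D.c))
    ⟨x₀, z₀, primalFeasible_iff.2 ⟨hx₀, by rwa [add_sub_right_comm]⟩⟩ (fun x z hxz => by
      have := hL.upperImage_subset hxz.mem_upperImage h hh
      rw [dotProduct_add, dotProduct_smul, smul_eq_mul] at this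
      rw [div_le_iff₀ hpos]
      linarith)
  refine ⟨x, z, u, w, ⟨hxz, fun x' z' h' => ?_⟩, ⟨huw, fun u' w' h' => ?_⟩, hval⟩
  · rw [← hval]
    exact h'.dual_le hC huw
  · rw [hval]
    exact hxz.dual_le hC h'

theorem IsOuterApproximation.dual_eq_primal (hq : 0 < q) (hS : D.feasible.Nonempty)
    (hC : D.cone = D.generatedCone) (hpointed : D.cone ∩ -D.cone = {0})
    (hc : D.c ∈ interior D.cone) {L : HRep q} (hL : D.IsOuterApproximation L) {t : Fin q → ℝ}
    {x : Fin n → ℝ} {z : ℝ} {u : Fin m → ℝ} {w : Fin q → ℝ} (hxz : D.PrimalOptimal t x z)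
    (huw : D.DualOptimal t u w) : D.b ⬝ᵥ u - t ⬝ᵥ w = z := by
  obtain ⟨x', z', u', w', hxz', huw', hval⟩ := hL.exists_optimal hq hS hC hpointed hc t
  refine le_antisymm (hxz.1.dual_le hC huw.1) ?_
  linarith [hxz.2 _ _ hxz'.1, huw.2 _ _ huw'.1]

theorem IsOuterApproximation.mem_convexHull_add_cone (hpointed : D.cone ∩ -D.cone = {0})
    {L : HRep q} (hL : D.IsOuterApproximation L) {y : Fin q → ℝ} (hy : y ∈ L.polyhedron) :
    ∃ v ∈ convexHull ℝ L.vertices, y - v ∈ D.cone := by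
  have := HRep.polyhedron_subset_convexHull_add (L := L) (by
    rw [hL.homogeneousCone_eq]
    exact fun d => eq_zero_of_mem_cone_of_neg_mem_cone hpointed) hy
  rw [hL.homogeneousCone_eq] at this
  obtain ⟨v, hv, d, hd, rfl⟩ := this
  exact ⟨v, hv, by simpa using hd⟩

theorem IsOuterApproximation.exists_isArgmin (hS : D.feasible.Nonempty)
    (hpointed : D.cone ∩ -D.cone = {0}) {L : HRep q} (hL : D.IsOuterApproximation L) :
    ∃ t, D.IsArgmin L t := by
  obtain ⟨y, hy⟩ := upperImage_nonempty hS
  obtain ⟨v, hv, _⟩ := hL.mem_convexHull_add_cone hpointed (hL.upperImage_subset hy)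
  have hne : L.vertices.Nonempty := convexHull_nonempty_iff.1 ⟨v, hv⟩
  obtain ⟨t, ht, hmin⟩ := Set.exists_min_image L.vertices D.f L.finite_vertices hne
  exact ⟨t, ht, hmin⟩

/-- Every image point lies above a convex combination `v` of vertices. Quasi-concavity compares `t`
with `v`, monotonicity compares `v` with `y`; both apply since `v` lies in `P[S] - C`. -/
theorem IsOuterApproximation.isArgmin_le (hf : QuasiconcaveOn ℝ Set.univ D.f)
    (hpointed : D.cone ∩ -D.cone = {0})
    (hM : ConeMonotoneOn D.cone (D.image - D.cone) D.f) {L : HRep q}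
    (hL : D.IsOuterApproximation L) {t : Fin q → ℝ} (ht : D.IsArgmin L t) {y : Fin q → ℝ}
    (hy : y ∈ D.image) : D.f t ≤ D.f y := by
  obtain ⟨v, hv, hyv⟩ := hL.mem_convexHull_add_cone hpointed
    (hL.upperImage_subset ⟨y, hy, 0, zero_mem_cone, add_zero y⟩)
  have htv : v ∈ {y | y ∈ Set.univ ∧ D.f t ≤ D.f y} :=
    convexHull_min (fun t' ht' => And.intro trivial (ht.2 t' ht')) (hf (D.f t)) hv
  exact htv.2.trans (hM v ⟨y, hy, y - v, hyv, sub_sub_cancel y v⟩ y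
    ⟨y, hy, 0, zero_mem_cone, sub_zero y⟩ hyv)

/-- A vertex of an outer approximation that belongs to the upper image dominates no other point of
the image. -/
theorem IsOuterApproximation.eq_of_mem_vertices {L : HRep q} (hL : D.IsOuterApproximation L)
    {t y : Fin q → ℝ} (ht : t ∈ L.vertices) (hy : y ∈ D.image) (hyt : t - y ∈ D.cone) :
    y = t := by
  -- `t` is the midpoint of `y` and `y + 2 (t - y)`, both in the upper image.
  refine ((mem_extremePoints.1 ht).2 y
    (hL.upperImage_subset ⟨y, hy, 0, zero_mem_cone, add_zero y⟩) (y + (2 : ℝ) • (t - y))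
    (hL.upperImage_subset ⟨y, hy, _, smul_mem_cone zero_le_two hyt, rfl⟩)
    ⟨1 / 2, 1 / 2, by norm_num, by norm_num, by norm_num, ?_⟩).1
  ext i
  simp only [Pi.add_apply, Pi.smul_apply, Pi.sub_apply, smul_eq_mul]
  ring

theorem IsOuterApproximation.isOptimal (hf : QuasiconcaveOn ℝ Set.univ D.f)
    (hpointed : D.cone ∩ -D.cone = {0}) (hc : D.c ∈ interior D.cone)
    (hM : ConeMonotoneOn D.cone (D.image - D.cone) D.f) {L : HRep q}
    (hL : D.IsOuterApproximation L) {t : Fin q → ℝ} (ht : D.IsArgmin L t) {x : Fin n → ℝ} {z : ℝ}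
    (hxz : D.PrimalFeasible t x z) (hz : z ≤ 0) : D.IsOptimal x := by
  rw [primalFeasible_iff] at hxz
  refine ⟨hxz.1, fun x' hx' => ?_⟩
  -- `t - P x` is the slack `t + z c - P x` plus `-z c`, and `-z ≥ 0`.
  have hcone : t - D.P *ᵥ x ∈ D.cone := by
    have := add_mem_cone hxz.2 (smul_mem_cone (neg_nonneg.2 hz) (interior_subset hc))
    convert this using 1
    rw [neg_smul]
    abel
  have : D.P *ᵥ x = t := hL.eq_of_mem_vertices ht.1 ⟨x, hxz.1, rfl⟩ hcone
  rw [this]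
  exact hL.isArgmin_le hf hpointed hM ht ⟨x', hx', rfl⟩

/-! ### Soundness and finiteness of runs -/

/-- Inside the loop the polyhedron is an outer approximation; a returned vector is optimal. -/
def IsSound (D : QCPData m n q o p) : State n q → Prop
  | .running L => D.IsOuterApproximation L
  | .done x => D.IsOptimal x

theorem Step.isSound (hf : QuasiconcaveOn ℝ Set.univ D.f) (hC : D.cone = D.generatedCone)
    (hpointed : D.cone ∩ -D.cone = {0}) (hc : D.c ∈ interior D.cone)
    (hM : ConeMonotoneOn D.cone (D.image - D.cone) D.f) {s s' : State n q} (h : D.Step s s')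
    (hs : D.IsSound s) : D.IsSound s' := by
  cases h with
  | cut L t x z u w ht hxz huw hz => exact IsOuterApproximation.cut hC hs huw.1
  | halt L t x z u w ht hxz huw hz =>
    exact IsOuterApproximation.isOptimal hf hpointed hc hM hs ht hxz.1 (not_lt.1 hz)

theorem Reaches.isSound (hf : QuasiconcaveOn ℝ Set.univ D.f) (hC : D.cone = D.generatedCone)
    (hpointed : D.cone ∩ -D.cone = {0}) (hc : D.c ∈ interior D.cone)
    (hM : ConeMonotoneOn D.cone (D.image - D.cone) D.f) {L₀ : HRep q}
    (h₀ : D.IsOuterApproximation L₀) {s : State n q} (h : D.Reaches L₀ s) : D.IsSound s := by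
  induction h with
  | refl => exact h₀
  | tail _ hstep ih => exact hstep.isSound hf hC hpointed hc hM ih

/-- Complementary slackness: if the primal solution `(x', z')` for `t'` has all the active rows of
the primal solution `(x, z)` for `t`, then the cut defined by a dual solution for `t` supports the
upper image at `t' + z' c` as well. -/
theorem dotProduct_eq_of_active_subset {t : Fin q → ℝ} {x : Fin n → ℝ} {z : ℝ} {u : Fin m → ℝ}
    {w : Fin q → ℝ} {l : Fin o → ℝ} (hx : x ∈ D.feasible) (hl : 0 ≤ l)
    (hslack : t + z • D.c - D.P *ᵥ x = D.Y *ᵥ l) (huw : D.DualFeasible u w)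
    (hval : D.b ⬝ᵥ u - t ⬝ᵥ w = z) {t' : Fin q → ℝ} {x' : Fin n → ℝ} {z' : ℝ} {l' : Fin o → ℝ}
    (hslack' : t' + z' • D.c - D.P *ᵥ x' = D.Y *ᵥ l')
    (hA : ∀ i, (D.A *ᵥ x) i = D.b i → (D.A *ᵥ x') i = D.b i)
    (hY : ∀ j, l j = 0 → l' j = 0) : w ⬝ᵥ (t' + z' • D.c) = D.b ⬝ᵥ u := by
  have h₁ : w ⬝ᵥ (t + z • D.c) = D.b ⬝ᵥ u := by
    rw [huw.dotProduct_translate]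
    linarith
  have h₂ : 0 ≤ u ⬝ᵥ (D.A *ᵥ x - D.b) :=
    dotProduct_nonneg_of_nonneg huw.2.2.2 (sub_nonneg.2 hx)
  have h₃ : 0 ≤ (D.Yᵀ *ᵥ w) ⬝ᵥ l := dotProduct_nonneg_of_nonneg huw.2.2.1 hl
  have h₄ : w ⬝ᵥ (t + z • D.c) = u ⬝ᵥ (D.A *ᵥ x) + (D.Yᵀ *ᵥ w) ⬝ᵥ l := by
    rw [← dotProduct_generator, ← hslack, dotProduct_sub,
      huw.dotProduct_image]
    ring
  have h₅ : w ⬝ᵥ (t' + z' • D.c) = u ⬝ᵥ (D.A *ᵥ x') + (D.Yᵀ *ᵥ w) ⬝ᵥ l' := by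
    rw [← dotProduct_generator, ← hslack', dotProduct_sub,
      huw.dotProduct_image]
    ring
  rw [dotProduct_sub, dotProduct_comm u D.b] at h₂
  -- By strong duality, two nonnegative slackness terms sum to zero, so both vanish, and they vanish
  -- termwise.
  have hu : u ⬝ᵥ (D.A *ᵥ x - D.b) = 0 := by
    rw [dotProduct_sub, dotProduct_comm u D.b]
    linarith
  have hw : (D.Yᵀ *ᵥ w) ⬝ᵥ l = 0 := by linarith
  have hu' : u ⬝ᵥ (D.A *ᵥ x' - D.b) = 0 := by
    rw [dotProduct, Finset.sum_eq_zero_iff_of_nonneg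
      fun i _ => mul_nonneg (huw.2.2.2 i) ((sub_nonneg.2 hx : 0 ≤ D.A *ᵥ x - D.b) i)] at hu
    refine Finset.sum_eq_zero fun i hi => ?_
    rcases mul_eq_zero.1 (hu i hi) with h | h
    · rw [h, zero_mul]
    · rw [Pi.sub_apply, hA i (sub_eq_zero.1 h), sub_self, mul_zero]
  have hw' : (D.Yᵀ *ᵥ w) ⬝ᵥ l' = 0 := by
    rw [dotProduct, Finset.sum_eq_zero_iff_of_nonneg
      fun j _ => mul_nonneg (huw.2.2.1 j) (hl j)] at hw
    refine Finset.sum_eq_zero fun j hj => ?_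
    rcases mul_eq_zero.1 (hw j hj) with h | h
    · rw [h, zero_mul]
    · rw [hY j h, mul_zero]
  rw [h₅, hw', add_zero]
  rw [dotProduct_sub, dotProduct_comm u D.b] at hu'
  linarith

theorem not_exists_infinite_run (hq : 0 < q) (hS : D.feasible.Nonempty)
    (hf : QuasiconcaveOn ℝ Set.univ D.f) (hC : D.cone = D.generatedCone)
    (hpointed : D.cone ∩ -D.cone = {0}) (hc : D.c ∈ interior D.cone)
    (hM : ConeMonotoneOn D.cone (D.image - D.cone) D.f) {L₀ : HRep q}
    (h₀ : D.IsOuterApproximation L₀) :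
    ¬ ∃ run : ℕ → State n q,
      run 0 = State.running L₀ ∧ ∀ k, D.Step (run k) (run (k + 1)) := by
  rintro ⟨run, hrun₀, hrun⟩
  have hsound : ∀ k, D.IsSound (run k) := fun k => by
    induction k with
    | zero => rw [hrun₀]; exact h₀
    | succ k ih => exact (hrun k).isSound hf hC hpointed hc hM ih
  have hdata : ∀ k, ∃ (L : HRep q) (t : Fin q → ℝ) (x : Fin n → ℝ) (z : ℝ) (u : Fin m → ℝ)
      (w : Fin q → ℝ) (l : Fin o → ℝ), run k = State.running L ∧
        run (k + 1) = State.running ((w, D.b ⬝ᵥ u) :: L) ∧ D.IsArgmin L t ∧ x ∈ D.feasible ∧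
        D.DualFeasible u w ∧ 0 < z ∧ D.b ⬝ᵥ u - t ⬝ᵥ w = z ∧ 0 ≤ l ∧
        t + z • D.c - D.P *ᵥ x = D.Y *ᵥ l := by
    intro k
    have hs := hsound k
    have h := hrun k
    have h' := hrun (k + 1)
    generalize run k = s at *
    generalize run (k + 1) = s' at *
    cases h with
    | cut L t x z u w ht hxz huw hz =>
      obtain ⟨hx, hmem⟩ := primalFeasible_iff.1 hxz.1
      rw [hC] at hmem
      obtain ⟨l, hl, hslack⟩ := hmem
      exact ⟨L, t, x, z, u, w, l, rfl, rfl, ht, hx, huw.1, hz,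
        IsOuterApproximation.dual_eq_primal hq hS hC hpointed hc hs hxz huw, hl, hslack⟩
    -- No step leaves a `done` state, so every step of an infinite run is a cut.
    | halt L t x z u w ht hxz huw hz => cases h'
  choose L t x z u w l hL hL' ht hx huw hz hval hl hslack using hdata
  have hcons : ∀ k, L (k + 1) = (w k, D.b ⬝ᵥ u k) :: L k := fun k =>
    State.running.inj ((hL (k + 1)).symm.trans (hL' k))
  have hsub : ∀ k j, (w k, D.b ⬝ᵥ u k) ∈ L (k + 1 + j) := fun k j => by
    induction j with
    | zero => rw [add_zero, hcons]; exact List.mem_cons_self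
    | succ j ih => rw [← add_assoc, hcons]; exact List.mem_cons_of_mem _ ih
  -- Pigeonhole on the patterns of active rows and vanishing cone coefficients.
  obtain ⟨k, k', hne, heq⟩ := Finite.exists_ne_map_eq_of_infinite
    fun k => (({i | (D.A *ᵥ x k) i = D.b i}, {j | l k j = 0}) : Set (Fin m) × Set (Fin o))
  wlog hlt : k < k' generalizing k k'
  · exact this k' k hne.symm heq.symm (lt_of_le_of_ne (not_lt.1 hlt) hne.symm)
  obtain ⟨hA, hY⟩ := Prod.ext_iff.1 heq
  have h := dotProduct_eq_of_active_subset (hx k) (hl k) (hslack k) (huw k) (hval k) (hslack k')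
    (fun i hi => (Set.ext_iff.1 hA i).1 hi) (fun j hj => (Set.ext_iff.1 hY j).1 hj)
  obtain ⟨j, rfl⟩ := Nat.exists_eq_add_of_le (Nat.succ_le_of_lt hlt)
  -- The later vertex satisfies the cut added in pass `k`, whereas `h` and `z > 0` put it strictly
  -- on the other side.
  have hmem := extremePoints_subset (ht _).1 _ (hsub k j)
  rw [(huw k).dotProduct_translate, dotProduct_comm] at h
  simp only [Nat.succ_eq_add_one] at h
  have := hz (k + 1 + j)
  simp only at hmem
  linarith

end QCPData

theorem mainTheorem1 {m n q o p : ℕ} (hq : 0 < q) (D : QCPData m n q o p)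
    (hS : D.feasible.Nonempty)
    (hf : QuasiconcaveOn ℝ Set.univ D.f)
    (hC : D.cone = D.generatedCone)
    (hpointed : D.cone ∩ -D.cone = {0})
    (hc : D.c ∈ interior D.cone)
    (hM : ConeMonotoneOn D.cone (D.image - D.cone) D.f)
    (hB : recessionCone D.image ⊆ D.cone)
    (L₀ : HRep q)
    (hO : D.upperImage ⊆ L₀.polyhedron)
    (hOrec : recessionCone L₀.polyhedron = D.cone) :
    -- every operation in the loop can be carried out
    (∀ L : HRep q, D.Reaches L₀ (QCPData.State.running L) →
      L.vertices.Finite ∧ (∃ t, D.IsArgmin L t) ∧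
        ∀ t, D.IsArgmin L t → (∃ x z, D.PrimalOptimal t x z) ∧ ∃ u w, D.DualOptimal t u w) ∧
    -- there is no infinite run
    (¬ ∃ run : ℕ → QCPData.State n q,
      run 0 = QCPData.State.running L₀ ∧ ∀ k, D.Step (run k) (run (k + 1))) ∧
    -- whatever is returned is an optimal solution
    (∀ x, D.Reaches L₀ (QCPData.State.done x) → D.IsOptimal x) := by
  have hne := (QCPData.upperImage_nonempty hS).mono hO
  have h₀ : D.IsOuterApproximation L₀ := ⟨hO, by rw [← hOrec, HRep.recessionCone_polyhedron hne]⟩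
  refine ⟨fun L hL => ?_, QCPData.not_exists_infinite_run hq hS hf hC hpointed hc hM h₀,
    fun x hx => hx.isSound hf hC hpointed hc hM h₀⟩
  have hL : D.IsOuterApproximation L := hL.isSound hf hC hpointed hc hM h₀
  refine ⟨L.finite_vertices, hL.exists_isArgmin hS hpointed, fun t _ => ?_⟩
  obtain ⟨x, z, u, w, hxz, huw, _⟩ := hL.exists_optimal hq hS hC hpointed hc t
  exact ⟨⟨x, z, hxz⟩, u, w, huw⟩
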